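/- Let $(A,\mathscr A,\mu)$ be a complete, non-atomic measure space with $0<\mu(A)<\infty$, and let $(\Omega,\mathscr F,\mathbb P)$ be a probability space whose $\sigma$-algebra $\mathscr F$ is a finite set. A *risk measure* is a functional $\varrho:L^\infty(\mathbb P)\to\mathbb R$ that is monotone ($\mathcal X\ge\mathcal Y$ implies $\varrho(\mathcal X)\ge\varrho(\mathcal Y)$) and cash additive ($\varrho(\mathcal X+c)=\varrho(\mathcal X)+c$ for $c\in\mathbb R$); it is a *convex risk measure* if in addition $\varrho(\lambda\mathcal X+(1-\lambda)\mathcal Y)\le\lambda\varrho(\mathcal X)+(1-\lambda)\varrho(\mathcal Y)$ for all $\mathcal X,\mathcal Y\in L^\infty(\mathbb P)$ and $\lambda\in[0,1]$. An allocation $(X_a)_{a\in A}$, i.e. a map $A\to L^\infty(\mathbb P)$, is *$\mathscr A$-measurable* if $a\mapsto\mathbb E^{\mathbb P}(X_a\mathcal Y)$ is $\mathscr A$-measurable for every $\mathcal Y\in L^1(\mathbb P)$. For $\mathcal X\in L^\infty(\mathbb P)$ let $\mathbb A(\mathcal X)$ be the set of $\mathscr A$-measurable allocations $(X_a)_{a\in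 A}$ such that, for every $\mathcal Y\in L^1(\mathbb P)$, the function $a\mapsto\mathbb E^{\mathbb P}(X_a\mathcal Y)$ is $\mu$-integrable and $\int_A\mathbb E^{\mathbb P}(X_a\mathcal Y)\,\mu(da)=\mathbb E^{\mathbb P}(\mathcal X\mathcal Y)$ (that is, $\mathcal X$ is the Gelfand integral $\int_A X_a\,\mu(da)$). Let $(\varrho_a)_{a\in A}$ be a family of risk measures on $L^\infty(\mathbb P)$, not assumed convex, such that $a\mapsto\varrho_a(X_a)$ is $\mathscr A$-measurable for every $\mathscr A$-measurable allocation $(X_a)_{a\in A}$. Its *integral infimal convolution* is $$\Big(\operatorname{\Box}_{a\in A}\varrho_a\,\mu(da)\Big)(\mathcal X)=\inf_{(X_a)_{a\in A}\in\mathbb A(\mathcal X)}\int_A\varrho_a(X_a)\,\mu(da)\in[-\infty,\infty],\qquad \mathcal X\in L^\infty(\mathbb P),$$ where the integral is $+\infty$ if $\int_A\varrho_a(X_a)^+\,\mu(da)=\infty$, and $\int_A\varrho_a(X_a)^+\,\mu(da)-\int_A\varrho_a(X_a)^-\,\mu(da)\in[-\infty,\infty)$ otherwise. If $\operatorname{\Box}_{a\in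 A}\varrho_a\,\mu(da)$ is finite at every $\mathcal X\in L^\infty(\mathbb P)$, then $\operatorname{\Box}_{a\in A}\varrho_a\,\mu(da)$ is a convex risk measure. -/

import Mathlib

open MeasureTheory Set
open scoped ENNReal

noncomputable section

namespace RiskSharing

/-- A measure is non-atomic if every measurable set of positive measure has a measurable subset of
strictly smaller positive measure. (For the finite measures considered here this says that there
are no atoms; it is stronger than the vanishing of the measure on singletons.) -/
def IsNonatomic {A : Type*} [MeasurableSpace A] (μ : Measure A) : Prop :=
  ∀ s : Set A, MeasurableSet s → 0 < μ s →
    ∃ t : Set A, t ⊆ s ∧ MeasurableSet t ∧ 0 < μ t ∧ μ t < μ s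

/-- The extended-real-valued integral of a measurable function `f : A → ℝ`: it is `+∞` if the
positive part has infinite integral, and `∫ f⁺ - ∫ f⁻` (possibly `-∞`) otherwise. -/
def extIntegral {A : Type*} [MeasurableSpace A] (μ : Measure A) (f : A → ℝ) : EReal :=
  open Classical in
  if (∫⁻ a, ENNReal.ofReal (f a) ∂μ) = ∞ then ⊤
  else ((∫⁻ a, ENNReal.ofReal (f a) ∂μ : ℝ≥0∞) : EReal)
    - ((∫⁻ a, ENNReal.ofReal (-f a) ∂μ : ℝ≥0∞) : EReal)

section RiskMeasures

variable {Ω : Type*} [MeasurableSpace Ω] (P : Measure Ω)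

/-- The pairing `E(X Y)` of `X ∈ L^∞(P)` with `Y ∈ L^1(P)`. -/
def pairing (X : Lp ℝ ∞ P) (Y : Lp ℝ 1 P) : ℝ :=
  ∫ ω, X ω * Y ω ∂P

variable {P}

/-- Risk measures on `L^∞(P)`: monotone and cash additive functionals. Positive values of a random
variable are losses. The order on `L^∞(P)` is the almost sure order. -/
structure IsRiskMeasure [IsFiniteMeasure P] (ϱ : Lp ℝ ∞ P → ℝ) : Prop where
  monotone : ∀ X Y : Lp ℝ ∞ P, Y ≤ X → ϱ Y ≤ ϱ X
  cash_additive : ∀ (X : Lp ℝ ∞ P) (c : ℝ), ϱ (X + Lp.const ∞ P c) = ϱ X + c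

/-- Convex risk measures. -/
structure IsConvexRiskMeasure [IsFiniteMeasure P] (ϱ : Lp ℝ ∞ P → ℝ) : Prop
    extends IsRiskMeasure ϱ where
  convex : ∀ (X Y : Lp ℝ ∞ P) (t : ℝ), 0 ≤ t → t ≤ 1 →
    ϱ (t • X + (1 - t) • Y) ≤ t * ϱ X + (1 - t) * ϱ Y

variable {A : Type*} [MeasurableSpace A]

/-- Weak-star measurability of an allocation `X : A → L^∞(P)`. -/
def MeasurableAllocation (X : A → Lp ℝ ∞ P) : Prop :=
  ∀ Y : Lp ℝ 1 P, Measurable fun a => pairing P (X a) Y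

/-- Gelfand integrability of an allocation. -/
def GelfandIntegrable (μ : Measure A) (X : A → Lp ℝ ∞ P) : Prop :=
  MeasurableAllocation X ∧ ∀ Y : Lp ℝ 1 P, Integrable (fun a => pairing P (X a) Y) μ

/-- `Z` is the Gelfand integral over `A` of the (Gelfand integrable) allocation `X`. -/
def IsGelfandIntegral (μ : Measure A) (X : A → Lp ℝ ∞ P) (Z : Lp ℝ ∞ P) : Prop :=
  ∀ Y : Lp ℝ 1 P, pairing P Z Y = ∫ a, pairing P (X a) Y ∂μ

/-- The set of `Z`-feasible allocations. -/
def feasible (μ : Measure A) (Z : Lp ℝ ∞ P) : Set (A → Lp ℝ ∞ P) :=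
  {X | GelfandIntegrable μ X ∧ IsGelfandIntegral μ X Z}

/-- Measurability of a family of functionals on `L^∞(P)`: measurable allocations are evaluated to
measurable functions. -/
def MeasurableFamily (ϱ : A → Lp ℝ ∞ P → ℝ) : Prop :=
  ∀ X : A → Lp ℝ ∞ P, MeasurableAllocation X → Measurable fun a => ϱ a (X a)

/-- The integral infimal convolution of a family of functionals on `L^∞(P)`. -/
def integralInfConv (μ : Measure A) (ϱ : A → Lp ℝ ∞ P → ℝ) (Z : Lp ℝ ∞ P) : EReal :=
  ⨅ X ∈ feasible μ Z, extIntegral μ fun a => ϱ a (X a)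

end RiskMeasures

end RiskSharing

end

/-! Convexity comes from Lyapunov's theorem, not from the individual risk measures. Given
allocations `X` feasible for `Z` and `X'` feasible for `Z'`, use `X` on a set `B` and `X'` off it.
The mixture is feasible for `t • Z + (1 - t) • Z'`, with the matching combination of aggregate
risks, once `B` carries the fraction `t` of the integrals of both risk functions and of all pairings
with `L^1`. Over a finite σ-algebra `L^1` is finite-dimensional, so finitely many integrals suffice,
and `IsNonatomic.exists_setIntegral_eq_mul` supplies `B`.

Lyapunov's theorem goes by induction on the number of functions. If every set can be halved for a
family, repeated halving yields an increasing chain of sets along which these integrals grow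
linearly. A window of length 1/2 sliding along the chain halves one further function, by the
intermediate value theorem (`Halvable.insert`). The base case is Sierpiński's theorem.

Monotonicity and cash additivity follow by spreading a change of the aggregate evenly over all
agents. -/

namespace RiskSharing

open Filter Topology

/-! ### Chains of sets obtained by repeated halving -/

section Lyapunov

variable {A : Type*}

/-- The initial segment of length `s` of `S`, at dyadic resolution `n`, for the halving
operation `h`. -/
noncomputable def dyadicSegment (h : Set A → Set A) : ℕ → Set A → ℝ → Set A
  | 0, _, _ => ∅
  | n + 1, S, s =>
    -- The leading binary digit of `s` decides whether the first half is cut again or kept whole.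
    if s < 1 / 2 then dyadicSegment h n (h S) (2 * s)
    else h S ∪ dyadicSegment h n (S \ h S) (2 * s - 1)

/-- The initial segment of length `s` of `S` for the halving operation `h`. -/
noncomputable def segment (h : Set A → Set A) (S : Set A) (s : ℝ) : Set A :=
  ⋃ n, dyadicSegment h n S s

variable {h : Set A → Set A}

lemma dyadicSegment_subset_succ (n : ℕ) (S : Set A) (s : ℝ) :
    dyadicSegment h n S s ⊆ dyadicSegment h (n + 1) S s := by
  induction n generalizing S s with
  | zero => exact empty_subset _
  | succ n ih =>
    rw [dyadicSegment, dyadicSegment]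
    split_ifs
    · exact ih _ _
    · exact union_subset_union_right _ (ih _ _)

variable [MeasurableSpace A] {μ : Measure A}

lemma dyadicSegment_subset (hsub : ∀ S, MeasurableSet S → h S ⊆ S)
    (hm : ∀ S, MeasurableSet S → MeasurableSet (h S)) (n : ℕ) (S : Set A) (hS : MeasurableSet S)
    (s : ℝ) : dyadicSegment h n S s ⊆ S := by
  induction n generalizing S s with
  | zero => exact empty_subset _
  | succ n ih =>
    rw [dyadicSegment]
    split_ifs
    · exact (ih _ (hm S hS) _).trans (hsub S hS)
    · exact union_subset (hsub S hS) ((ih _ (hS.diff (hm S hS)) _).trans sdiff_subset)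

lemma measurableSet_dyadicSegment (hm : ∀ S, MeasurableSet S → MeasurableSet (h S)) (n : ℕ)
    (S : Set A) (hS : MeasurableSet S) (s : ℝ) : MeasurableSet (dyadicSegment h n S s) := by
  induction n generalizing S s with
  | zero => exact .empty
  | succ n ih =>
    rw [dyadicSegment]
    split_ifs
    · exact ih _ (hm S hS) _
    · exact (hm S hS).union (ih _ (hS.diff (hm S hS)) _)

lemma dyadicSegment_mono (hsub : ∀ S, MeasurableSet S → h S ⊆ S)
    (hm : ∀ S, MeasurableSet S → MeasurableSet (h S)) (n : ℕ) (S : Set A) (hS : MeasurableSet S)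
    {s t : ℝ} (hst : s ≤ t) : dyadicSegment h n S s ⊆ dyadicSegment h n S t := by
  induction n generalizing S s t with
  | zero => exact Subset.rfl
  | succ n ih =>
    rw [dyadicSegment, dyadicSegment]
    split_ifs with h1 h2 h2
    · exact ih _ (hm S hS) (by linarith)
    · exact (dyadicSegment_subset hsub hm n _ (hm S hS) _).trans subset_union_left
    · linarith
    · exact union_subset_union_right _ (ih _ (hS.diff (hm S hS)) (by linarith))

/-- Each binary digit leaves the choice open only inside one half of the previous set, and that half
carries half of the integral; so the error halves at every step. -/
lemma abs_setIntegral_dyadicSegment_sub_le (hsub : ∀ S, MeasurableSet S → h S ⊆ S)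
    (hm : ∀ S, MeasurableSet S → MeasurableSet (h S)) {f : A → ℝ} (hf : Integrable f μ)
    (hhalf : ∀ S, MeasurableSet S → ∫ a in h S, f a ∂μ = (∫ a in S, f a ∂μ) / 2)
    (n : ℕ) (S : Set A) (hS : MeasurableSet S) {s : ℝ} (hs0 : 0 ≤ s) (hs1 : s ≤ 1) :
    |∫ a in dyadicSegment h n S s, f a ∂μ - s * ∫ a in S, f a ∂μ| ≤
      |∫ a in S, f a ∂μ| * (1 / 2) ^ n := by
  induction n generalizing S s with
  | zero =>
    simp only [dyadicSegment, Measure.restrict_empty, integral_zero_measure, zero_sub, abs_neg,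
      pow_zero, mul_one, abs_mul, abs_of_nonneg hs0]
    exact mul_le_of_le_one_left (abs_nonneg _) hs1
  | succ n ih =>
    rw [dyadicSegment]
    split_ifs with h1
    · have := ih _ (hm S hS) (s := 2 * s) (by linarith) (by linarith)
      rw [hhalf S hS, abs_div, abs_of_pos (two_pos : (0 : ℝ) < 2)] at this
      rw [pow_succ]
      convert this using 1
      · congr 1; ring
      · ring
    · have := ih _ (hS.diff (hm S hS)) (s := 2 * s - 1) (by linarith) (by linarith)
      have hd : ∫ a in S \ h S, f a ∂μ = (∫ a in S, f a ∂μ) / 2 := by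
        rw [setIntegral_sdiff (hm S hS) hf.integrableOn (hsub S hS), hhalf S hS]; ring
      rw [hd, abs_div, abs_of_pos (two_pos : (0 : ℝ) < 2)] at this
      rw [pow_succ, setIntegral_union (disjoint_sdiff_right.mono_right
        (dyadicSegment_subset hsub hm n _ (hS.diff (hm S hS)) _))
        (measurableSet_dyadicSegment hm n _ (hS.diff (hm S hS)) _)
        hf.integrableOn hf.integrableOn, hhalf S hS]
      convert this using 1
      · congr 1; ring
      · ring

lemma measurableSet_segment (hm : ∀ S, MeasurableSet S → MeasurableSet (h S))
    {S : Set A} (hS : MeasurableSet S) (s : ℝ) : MeasurableSet (segment h S s) :=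
  .iUnion fun n => measurableSet_dyadicSegment hm n S hS s

lemma segment_subset (hsub : ∀ S, MeasurableSet S → h S ⊆ S)
    (hm : ∀ S, MeasurableSet S → MeasurableSet (h S)) {S : Set A} (hS : MeasurableSet S) (s : ℝ) :
    segment h S s ⊆ S :=
  iUnion_subset fun n => dyadicSegment_subset hsub hm n S hS s

lemma segment_mono (hsub : ∀ S, MeasurableSet S → h S ⊆ S)
    (hm : ∀ S, MeasurableSet S → MeasurableSet (h S)) {S : Set A} (hS : MeasurableSet S) :
    Monotone (segment h S) := fun _ _ hst =>
  iUnion_mono fun n => dyadicSegment_mono hsub hm n S hS hst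

lemma setIntegral_segment (hsub : ∀ S, MeasurableSet S → h S ⊆ S)
    (hm : ∀ S, MeasurableSet S → MeasurableSet (h S)) {f : A → ℝ} (hf : Integrable f μ)
    (hhalf : ∀ S, MeasurableSet S → ∫ a in h S, f a ∂μ = (∫ a in S, f a ∂μ) / 2)
    {S : Set A} (hS : MeasurableSet S) {s : ℝ} (hs0 : 0 ≤ s) (hs1 : s ≤ 1) :
    ∫ a in segment h S s, f a ∂μ = s * ∫ a in S, f a ∂μ := by
  have h1 : Tendsto (fun n => ∫ a in dyadicSegment h n S s, f a ∂μ) atTop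
      (𝓝 (∫ a in segment h S s, f a ∂μ)) :=
    tendsto_setIntegral_of_monotone (fun n => measurableSet_dyadicSegment hm n S hS s)
      (monotone_nat_of_le_succ fun n => dyadicSegment_subset_succ n S s) hf.integrableOn
  have h2 : Tendsto (fun n : ℕ => |∫ a in S, f a ∂μ| * (1 / 2 : ℝ) ^ n) atTop (𝓝 0) := by
    simpa using (tendsto_pow_atTop_nhds_zero_of_lt_one (by norm_num : (0 : ℝ) ≤ 1 / 2)
      (by norm_num)).const_mul |∫ a in S, f a ∂μ|
  have h3 := squeeze_zero_norm (fun n => (Real.norm_eq_abs _).trans_le <| abs_setIntegral_dyadicSegment_sub_le hsub hm hf hhalf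
    n S hS hs0 hs1) h2
  exact tendsto_nhds_unique h1 (by simpa using h3.add_const (s * ∫ a in S, f a ∂μ))

/-! ### Sierpiński's theorem by greedy exhaustion -/

variable [IsFiniteMeasure μ]

lemma measureReal_pos_iff {S : Set A} : 0 < μ.real S ↔ 0 < μ S := by
  rw [measureReal_def, ENNReal.toReal_pos_iff]
  exact and_iff_left (measure_lt_top _ _)

lemma IsNonatomic.exists_subset_half_le (hμ : IsNonatomic μ) {S : Set A} (hS : MeasurableSet S)
    (hpos : 0 < μ.real S) :
    ∃ D ⊆ S, MeasurableSet D ∧ 0 < μ.real D ∧ μ.real D ≤ μ.real S / 2 := by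
  obtain ⟨t, htS, ht, ht0, htlt⟩ := hμ S hS (measureReal_pos_iff.1 hpos)
  have h0 : 0 < μ.real t := measureReal_pos_iff.2 ht0
  have hlt : μ.real t < μ.real S := (ENNReal.toReal_lt_toReal (measure_ne_top _ _)
    (measure_ne_top _ _)).2 htlt
  have hd : μ.real (S \ t) = μ.real S - μ.real t := measureReal_sdiff htS ht
  rcases le_total (μ.real t) (μ.real S / 2) with h | h
  · exact ⟨t, htS, ht, h0, h⟩
  · exact ⟨S \ t, sdiff_subset, hS.diff ht, by linarith, by linarith⟩

lemma IsNonatomic.exists_subset_small (hμ : IsNonatomic μ) {S : Set A} (hS : MeasurableSet S)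
    (hpos : 0 < μ.real S) {ε : ℝ} (hε : 0 < ε) :
    ∃ D ⊆ S, MeasurableSet D ∧ 0 < μ.real D ∧ μ.real D ≤ ε := by
  have key : ∀ n : ℕ, ∃ D ⊆ S, MeasurableSet D ∧ 0 < μ.real D ∧
      μ.real D ≤ μ.real S * (1 / 2) ^ n := by
    intro n
    induction n with
    | zero => exact ⟨S, Subset.rfl, hS, hpos, by simp⟩
    | succ n ih =>
      obtain ⟨D, hDS, hD, hD0, hDle⟩ := ih
      obtain ⟨D', hD'D, hD', hD'0, hD'le⟩ := hμ.exists_subset_half_le hD hD0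
      exact ⟨D', hD'D.trans hDS, hD', hD'0, by rw [pow_succ]; linarith⟩
  obtain ⟨n, hn⟩ := exists_pow_lt_of_lt_one (div_pos hε hpos) (by norm_num : (1 / 2 : ℝ) < 1)
  obtain ⟨D, hDS, hD, hD0, hDle⟩ := key n
  refine ⟨D, hDS, hD, hD0, hDle.trans ?_⟩
  rw [lt_div_iff₀ hpos] at hn
  linarith

/-- One step of exhaustion: a set of measure at most `c` can be enlarged, keeping its measure
at most `c`, by at least half of what is possible. -/
lemma exists_greedy_extension {S B : Set A} {c : ℝ}
    (hB : MeasurableSet B) (hBS : B ⊆ S) (hBc : μ.real B ≤ c) :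
    ∃ B', MeasurableSet B' ∧ B' ⊆ S ∧ μ.real B' ≤ c ∧ B ⊆ B' ∧
      ∀ D, MeasurableSet D → D ⊆ S \ B → μ.real B + μ.real D ≤ c →
        μ.real D ≤ 2 * (μ.real B' - μ.real B) := by
  let V : Set ℝ := {v | ∃ D, MeasurableSet D ∧ D ⊆ S \ B ∧ μ.real B + μ.real D ≤ c ∧ μ.real D = v}
  have hbdd : BddAbove V := ⟨c - μ.real B, by rintro v ⟨D, -, -, h, rfl⟩; linarith⟩
  by_cases hV : ∃ v ∈ V, 0 < v
  · obtain ⟨v, hv, hv0⟩ := hV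
    have hs : 0 < sSup V := hv0.trans_le (le_csSup hbdd hv)
    -- The supremum need not be attained; settling for more than half of it gives the factor 2.
    obtain ⟨-, ⟨D, hD, hDS, hDc, rfl⟩, hlt⟩ := exists_lt_of_lt_csSup ⟨v, hv⟩ (half_lt_self hs)
    have hm : μ.real (B ∪ D) = μ.real B + μ.real D :=
      measureReal_union (disjoint_sdiff_right.mono_right hDS) hD
    refine ⟨B ∪ D, hB.union hD, union_subset hBS (hDS.trans sdiff_subset), hm ▸ hDc,
      subset_union_left, fun D' hD' hD'S hD'c => ?_⟩
    have := le_csSup hbdd (show μ.real D' ∈ V from ⟨D', hD', hD'S, hD'c, rfl⟩)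
    rw [hm]
    linarith
  · refine ⟨B, hB, hBS, hBc, Subset.rfl, fun D hD hDS hDc => ?_⟩
    have := not_lt.1 fun h => hV ⟨_, ⟨D, hD, hDS, hDc, rfl⟩, h⟩
    simpa using this

lemma tendsto_measureReal_iUnion {B : ℕ → Set A} (hB : Monotone B) :
    Tendsto (fun n => μ.real (B n)) atTop (𝓝 (μ.real (⋃ n, B n))) :=
  (ENNReal.tendsto_toReal (measure_ne_top _ _)).comp (tendsto_measure_iUnion_atTop hB)

/-- Sierpiński's theorem: a finite non-atomic measure takes all intermediate values. -/
theorem IsNonatomic.exists_subset_measureReal_eq (hμ : IsNonatomic μ) {S : Set A}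
    (hS : MeasurableSet S) {c : ℝ} (hc0 : 0 ≤ c) (hcS : c ≤ μ.real S) :
    ∃ B ⊆ S, MeasurableSet B ∧ μ.real B = c := by
  let T := {B : Set A // MeasurableSet B ∧ B ⊆ S ∧ μ.real B ≤ c}
  choose next hnm hnS hnc hsub hmax using fun B : T =>
    exists_greedy_extension (μ := μ) B.2.1 B.2.2.1 B.2.2.2
  let B : ℕ → T := fun n => Nat.rec ⟨∅, .empty, empty_subset _, by simpa using hc0⟩
    (fun _ b => ⟨next b, hnm b, hnS b, hnc b⟩) n
  have hmono : Monotone fun n => (B n).1 := monotone_nat_of_le_succ fun n => hsub (B n)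
  have htend := tendsto_measureReal_iUnion (μ := μ) hmono
  set U := ⋃ n, (B n).1 with hU
  have hUm : MeasurableSet U := .iUnion fun n => (B n).2.1
  have hUS : U ⊆ S := iUnion_subset fun n => (B n).2.2.1
  have hUc : μ.real U ≤ c := le_of_tendsto' htend fun n => (B n).2.2.2
  refine ⟨U, hUS, hUm, hUc.antisymm (not_lt.1 fun hlt => ?_)⟩
  -- If the union fell short of `c`, this `D` would still fit at every stage, so every greedy
  -- increment would be at least half its measure; but the increments tend to zero.
  obtain ⟨D, hDS, hD, hD0, hDle⟩ := hμ.exists_subset_small (hS.diff hUm)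
    (by rw [measureReal_sdiff hUS hUm]; linarith) (sub_pos.2 hlt)
  have hle : ∀ n, μ.real D ≤ 2 * (μ.real (B (n + 1)).1 - μ.real (B n).1) := fun n =>
    hmax (B n) D hD (hDS.trans (sdiff_subset_sdiff_right (subset_iUnion (fun n => (B n).1) n)))
      (by
        have : μ.real (B n).1 ≤ μ.real U := measureReal_mono (subset_iUnion (fun n => (B n).1) n)
        linarith)
  have hlim := ((((tendsto_add_atTop_iff_nat 1).2 htend).sub htend).const_mul 2)
  have := ge_of_tendsto' hlim hle
  simp only [sub_self, mul_zero] at this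
  linarith

/-! ### Lyapunov's theorem by induction on the number of functions -/

/-- Every measurable set can be halved simultaneously for all integrals of functions in `F`. -/
def Halvable (μ : Measure A) (F : Set (A → ℝ)) : Prop :=
  ∀ S, MeasurableSet S → ∃ B ⊆ S, MeasurableSet B ∧
    ∀ f ∈ F, ∫ a in B, f a ∂μ = (∫ a in S, f a ∂μ) / 2

/-- Here `g` itself need not be halved by `h`: the segments for `s` and `t` differ by a set of
measure `|s - t| * μ.real S`, and the integral of `g` is absolutely continuous. -/
lemma continuousOn_setIntegral_segment (hsub : ∀ S, MeasurableSet S → h S ⊆ S)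
    (hm : ∀ S, MeasurableSet S → MeasurableSet (h S))
    (hhalf : ∀ S, MeasurableSet S → μ.real (h S) = μ.real S / 2)
    {g : A → ℝ} (hg : Integrable g μ) {S : Set A} (hS : MeasurableSet S) :
    ContinuousOn (fun s => ∫ a in segment h S s, g a ∂μ) (Icc 0 1) := by
  have hreal : ∀ s ∈ Icc (0 : ℝ) 1, μ.real (segment h S s) = s * μ.real S := fun s hs => by
    simpa using setIntegral_segment (f := fun _ => (1 : ℝ)) hsub hm (integrable_const _)
      (by simpa using hhalf) hS hs.1 hs.2
  have hmeas : ∀ s t, s ∈ Icc (0 : ℝ) 1 → t ∈ Icc (0 : ℝ) 1 →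
      μ (segment h S s \ segment h S t) ≤ ENNReal.ofReal (|s - t| * μ.real S) := by
    intro s t hs ht
    rw [ENNReal.le_ofReal_iff_toReal_le (measure_ne_top _ _) (by positivity)]
    rcases le_total s t with hst | hst
    · simp only [sdiff_eq_empty.2 (segment_mono hsub hm hS hst), measure_empty, ENNReal.toReal_zero]
      positivity
    · change μ.real _ ≤ _
      rw [measureReal_sdiff (segment_mono hsub hm hS hst) (measurableSet_segment hm hS t),
        hreal s hs, hreal t ht, abs_of_nonneg (sub_nonneg.2 hst), sub_mul]
  intro t ht
  have hlim : Tendsto (fun s : ℝ => ENNReal.ofReal (|s - t| * μ.real S)) (𝓝[Icc 0 1] t) (𝓝 0) := by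
    have : Continuous fun s : ℝ => ENNReal.ofReal (|s - t| * μ.real S) :=
      ENNReal.continuous_ofReal.comp (by fun_prop)
    simpa using (this.tendsto t).mono_left nhdsWithin_le_nhds
  have hA : Tendsto (fun s => ∫ a in segment h S s \ segment h S t, g a ∂μ) (𝓝[Icc 0 1] t)
      (𝓝 0) :=
    hg.tendsto_setIntegral_nhds_zero (tendsto_of_tendsto_of_tendsto_of_le_of_le'
      tendsto_const_nhds hlim (Eventually.of_forall fun _ => zero_le)
      (eventually_mem_nhdsWithin.mono fun s hs => hmeas s t hs ht))
  have hB : Tendsto (fun s => ∫ a in segment h S t \ segment h S s, g a ∂μ) (𝓝[Icc 0 1] t)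
      (𝓝 0) :=
    hg.tendsto_setIntegral_nhds_zero (tendsto_of_tendsto_of_tendsto_of_le_of_le'
      tendsto_const_nhds hlim (Eventually.of_forall fun _ => zero_le)
      (eventually_mem_nhdsWithin.mono fun s hs => by
        rw [abs_sub_comm]; exact hmeas t s ht hs))
  have hC := (hA.sub hB).add_const (∫ a in segment h S t, g a ∂μ)
  rw [sub_zero, zero_add] at hC
  refine hC.congr fun s => ?_
  have e1 := integral_inter_add_sdiff (μ := μ) (s := segment h S s)
    (measurableSet_segment hm hS t) hg.integrableOn
  have e2 := integral_inter_add_sdiff (μ := μ) (s := segment h S t)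
    (measurableSet_segment hm hS s) hg.integrableOn
  rw [inter_comm] at e2
  linarith

/-- Any window of length 1/2 in the chain already halves every function in `F`, which leaves its
position free to be tuned for `g`. The constant 1 in `F` ties the chain to `μ` and so makes the
integral of `g` continuous in the position. -/
lemma Halvable.insert {F : Set (A → ℝ)} (hF : Halvable μ F) (h1 : (fun _ => 1) ∈ F)
    (hint : ∀ f ∈ F, Integrable f μ) {g : A → ℝ} (hg : Integrable g μ) :
    Halvable μ (insert g F) := by
  intro S hS
  choose! h hsub hm hhalf using hF
  have hreal : ∀ S, MeasurableSet S → μ.real (h S) = μ.real S / 2 := fun S hS => by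
    simpa using hhalf S hS _ h1
  have hseg : ∀ f ∈ F, ∀ s ∈ Icc (0 : ℝ) 1,
      ∫ a in segment h S s, f a ∂μ = s * ∫ a in S, f a ∂μ := fun f hf s hs =>
    setIntegral_segment hsub hm (hint f hf) (fun S hS => hhalf S hS f hf) hS hs.1 hs.2
  have hsegr : ∀ s ∈ Icc (0 : ℝ) 1, μ.real (segment h S s) = s * μ.real S := fun s hs => by
    simpa using hseg _ h1 s hs
  let G : ℝ → ℝ := fun s => ∫ a in segment h S s, g a ∂μ
  have hG : ContinuousOn G (Icc 0 1) := continuousOn_setIntegral_segment hsub hm hreal hg hS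
  have hG0 : G 0 = 0 := setIntegral_measure_zero _ <| by
    simpa [measureReal_eq_zero_iff] using hsegr 0 (by simp)
  have hG1 : G 1 = ∫ a in S, g a ∂μ := by
    have hd : μ.real (S \ segment h S 1) = 0 := by
      rw [measureReal_sdiff (segment_subset hsub hm hS 1) (measurableSet_segment hm hS 1),
        hsegr 1 (by simp)]
      ring
    have := setIntegral_sdiff (measurableSet_segment hm hS 1) hg.integrableOn
      (segment_subset hsub hm hS 1) (μ := μ)
    rw [setIntegral_measure_zero _ ((measureReal_eq_zero_iff).1 hd)] at this
    exact (sub_eq_zero.1 this.symm).symm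
  let φ : ℝ → ℝ := fun s => G (s + 1 / 2) - G s
  have hφ : ContinuousOn φ (Icc 0 (1 / 2)) := by
    refine ContinuousOn.sub (hG.comp (by fun_prop) fun s hs => ?_)
      (hG.mono (Icc_subset_Icc_right (by norm_num)))
    exact ⟨by linarith [hs.1], by linarith [hs.2]⟩
  have hφ0 : φ 0 = G (1 / 2) := by simp [φ, hG0]
  have hφ1 : φ (1 / 2) = (∫ a in S, g a ∂μ) - G (1 / 2) := by
    simp only [φ]; norm_num [hG1]
  -- The two extreme windows together make up `S` up to a null set, so half the integral lies
  -- between `φ 0` and `φ (1 / 2)`.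
  obtain ⟨s, hs, hsφ⟩ : ∃ s ∈ Icc (0 : ℝ) (1 / 2), φ s = (∫ a in S, g a ∂μ) / 2 := by
    rcases le_total (G (1 / 2)) ((∫ a in S, g a ∂μ) / 2) with hle | hle
    · exact intermediate_value_Icc (by norm_num) hφ ⟨by linarith, by linarith⟩
    · exact intermediate_value_Icc' (by norm_num) hφ ⟨by linarith, by linarith⟩
  have hdiff : ∀ f : A → ℝ, Integrable f μ →
      ∫ a in segment h S (s + 1 / 2) \ segment h S s, f a ∂μ =
        ∫ a in segment h S (s + 1 / 2), f a ∂μ - ∫ a in segment h S s, f a ∂μ := fun f hf =>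
    setIntegral_sdiff (measurableSet_segment hm hS s) hf.integrableOn
      (segment_mono hsub hm hS (by linarith))
  refine ⟨segment h S (s + 1 / 2) \ segment h S s,
    sdiff_subset.trans (segment_subset hsub hm hS _),
    (measurableSet_segment hm hS _).diff (measurableSet_segment hm hS _), ?_⟩
  rintro f (rfl | hf)
  · rw [hdiff _ hg]
    exact hsφ
  · rw [hdiff f (hint f hf), hseg f hf _ ⟨by linarith [hs.1], by linarith [hs.2]⟩,
      hseg f hf s ⟨hs.1, by linarith [hs.2]⟩]
    ring

lemma IsNonatomic.halvable (hμ : IsNonatomic μ) {F : Set (A → ℝ)} (hF : F.Finite)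
    (hint : ∀ f ∈ F, Integrable f μ) : Halvable μ (insert (fun _ => 1) F) := by
  induction F, hF using Set.Finite.induction_on with
  | empty =>
    intro S hS
    obtain ⟨B, hBS, hB, hBe⟩ := hμ.exists_subset_measureReal_eq hS
      (c := μ.real S / 2) (by positivity) (half_le_self measureReal_nonneg)
    exact ⟨B, hBS, hB, by simpa using hBe⟩
  | insert _ _ ih =>
    rw [insert_comm]
    refine (ih fun f hf => hint f (mem_insert_of_mem _ hf)).insert (mem_insert _ _) ?_
      (hint _ (mem_insert _ _))
    rintro f (rfl | hf)
    · exact integrable_const _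
    · exact hint f (mem_insert_of_mem _ hf)

/-- Lyapunov's convexity theorem, for finitely many signed measures with densities with respect
to a finite non-atomic measure. -/
theorem IsNonatomic.exists_setIntegral_eq_mul (hμ : IsNonatomic μ) {F : Set (A → ℝ)}
    (hF : F.Finite) (hint : ∀ f ∈ F, Integrable f μ) {t : ℝ} (ht0 : 0 ≤ t) (ht1 : t ≤ 1) :
    ∃ B, MeasurableSet B ∧ ∀ f ∈ F, ∫ a in B, f a ∂μ = t * ∫ a, f a ∂μ := by
  have hh := hμ.halvable hF hint
  choose! h hsub hm hhalf using hh
  refine ⟨segment h univ t, measurableSet_segment hm .univ t, fun f hf => ?_⟩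
  simpa using setIntegral_segment hsub hm (hint f hf)
    (fun S hS => hhalf S hS f (mem_insert_of_mem _ hf)) .univ ht0 ht1

end Lyapunov

end RiskSharing

namespace RiskSharing

/-! ### The pairing of `L^∞` with `L^1` -/

section Pairing

variable {Ω : Type*} [MeasurableSpace Ω] {P : Measure Ω}

lemma integrable_mul_Lp (X : Lp ℝ ∞ P) (Y : Lp ℝ 1 P) : Integrable (fun ω => X ω * Y ω) P :=
  (Lp.memLp X).integrable_mul (Lp.memLp Y)

lemma pairing_add_left (X X' : Lp ℝ ∞ P) (Y : Lp ℝ 1 P) :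
    pairing P (X + X') Y = pairing P X Y + pairing P X' Y := by
  rw [pairing, pairing, pairing,
    ← integral_add (integrable_mul_Lp X Y) (integrable_mul_Lp X' Y)]
  refine integral_congr_ae ?_
  filter_upwards [Lp.coeFn_add X X'] with ω h
  rw [h, Pi.add_apply, add_mul]

lemma pairing_smul_left (c : ℝ) (X : Lp ℝ ∞ P) (Y : Lp ℝ 1 P) :
    pairing P (c • X) Y = c * pairing P X Y := by
  rw [pairing, pairing, ← integral_const_mul]
  refine integral_congr_ae ?_
  filter_upwards [Lp.coeFn_smul c X] with ω h
  rw [h, Pi.smul_apply, smul_eq_mul, mul_assoc]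

lemma pairing_add_right (X : Lp ℝ ∞ P) (Y Y' : Lp ℝ 1 P) :
    pairing P X (Y + Y') = pairing P X Y + pairing P X Y' := by
  rw [pairing, pairing, pairing,
    ← integral_add (integrable_mul_Lp X Y) (integrable_mul_Lp X Y')]
  refine integral_congr_ae ?_
  filter_upwards [Lp.coeFn_add Y Y'] with ω h
  rw [h, Pi.add_apply, mul_add]

lemma pairing_smul_right (c : ℝ) (X : Lp ℝ ∞ P) (Y : Lp ℝ 1 P) :
    pairing P X (c • Y) = c * pairing P X Y := by
  rw [pairing, pairing, ← integral_const_mul]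
  refine integral_congr_ae ?_
  filter_upwards [Lp.coeFn_smul c Y] with ω h
  rw [h, Pi.smul_apply, smul_eq_mul, mul_left_comm]

lemma pairing_zero_right (X : Lp ℝ ∞ P) : pairing P X 0 = 0 := by
  simpa using pairing_smul_right 0 X 0

/-- Over a finite σ-algebra, `L^1` is spanned by the finitely many indicator functions. -/
lemma exists_finite_span_eq_top [IsFiniteMeasure P]
    (hF : {s : Set Ω | MeasurableSet s}.Finite) :
    ∃ W : Set (Lp ℝ 1 P), W.Finite ∧ Submodule.span ℝ W = ⊤ := by
  have : Finite {s : Set Ω // MeasurableSet s} := hF.to_subtype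
  let e : {s : Set Ω // MeasurableSet s} → Lp ℝ 1 P := fun s =>
    indicatorConstLp 1 s.2 (measure_ne_top P s.1) (1 : ℝ)
  have hW : (range e).Finite := finite_range e
  refine ⟨range e, hW, eq_top_iff.2 fun f _ => ?_⟩
  -- A finite-dimensional span is closed, so containing the simple functions it is everything.
  have : FiniteDimensional ℝ (Submodule.span ℝ (range e)) := .span_of_finite ℝ hW
  refine Lp.induction ENNReal.one_ne_top (fun f => f ∈ Submodule.span ℝ (range e)) ?_ ?_
    (Submodule.span ℝ (range e)).closed_of_finiteDimensional f
  · intro c s hs hμs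
    have hc : (Lp.simpleFunc.indicatorConst 1 hs hμs.ne c : Lp ℝ 1 P) = c • e ⟨s, hs⟩ := by
      rw [Lp.simpleFunc.coe_indicatorConst]
      ext1
      refine indicatorConstLp_coeFn.trans ((Lp.coeFn_smul c _).trans ?_).symm
      filter_upwards [indicatorConstLp_coeFn (p := 1) (hs := hs) (hμs := measure_ne_top P s)
        (c := (1 : ℝ))] with ω hω
      rw [Pi.smul_apply, hω]
      by_cases h : ω ∈ s <;> simp [h]
    rw [hc]
    exact Submodule.smul_mem _ c (Submodule.subset_span ⟨_, rfl⟩)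
  · intro f g hf hg _ h1 h2
    exact Submodule.add_mem _ h1 h2

end Pairing

/-! ### The extended integral -/

section ExtIntegral

variable {A : Type*} [MeasurableSpace A] {μ : Measure A} {f : A → ℝ}

lemma extIntegral_eq_coe_integral (hf : Integrable f μ) :
    extIntegral μ f = ((∫ a, f a ∂μ : ℝ) : EReal) := by
  have h1 : ∫⁻ a, ENNReal.ofReal (f a) ∂μ ≠ ∞ := hf.lintegral_lt_top.ne
  have h2 : ∫⁻ a, ENNReal.ofReal (-f a) ∂μ ≠ ∞ := hf.neg.lintegral_lt_top.ne
  rw [extIntegral, if_neg h1, integral_eq_lintegral_pos_part_sub_lintegral_neg_part hf,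
    EReal.coe_sub, EReal.coe_ennreal_toReal h1, EReal.coe_ennreal_toReal h2]

lemma integrable_of_lintegral_ofReal_ne_top (hf : Measurable f)
    (h1 : ∫⁻ a, ENNReal.ofReal (f a) ∂μ ≠ ∞) (hbot : extIntegral μ f ≠ ⊥) : Integrable f μ := by
  have h2 : ∫⁻ a, ENNReal.ofReal (-f a) ∂μ ≠ ∞ := fun h2 => hbot <| by
    rw [extIntegral, if_neg h1, h2, EReal.coe_ennreal_top, sub_eq_add_neg, EReal.neg_top,
      EReal.add_bot]
  refine ⟨hf.aestronglyMeasurable, (hasFiniteIntegral_iff_norm f).2 ?_⟩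
  refine (lintegral_mono (g := fun a => ENNReal.ofReal (f a) + ENNReal.ofReal (-f a))
    fun a => ?_).trans_lt ?_
  · rw [Real.norm_eq_abs]
    rcases abs_cases (f a) with ⟨h, -⟩ | ⟨h, -⟩ <;> rw [h]
    · exact le_self_add
    · exact le_add_self
  · rw [lintegral_add_left hf.ennreal_ofReal]
    exact ENNReal.add_lt_top.2 ⟨h1.lt_top, h2.lt_top⟩

lemma integrable_of_extIntegral_ne (hf : Measurable f) (htop : extIntegral μ f ≠ ⊤)
    (hbot : extIntegral μ f ≠ ⊥) : Integrable f μ :=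
  integrable_of_lintegral_ofReal_ne_top hf (fun h => htop (by rw [extIntegral, if_pos h])) hbot

end ExtIntegral

/-! ### Feasible allocations and attainable aggregate risks -/

section Feasible

variable {Ω : Type*} [MeasurableSpace Ω] {P : Measure Ω}
  {A : Type*} [MeasurableSpace A] {μ : Measure A} {ϱ : A → Lp ℝ ∞ P → ℝ}

/-- The finite aggregate risks of feasible allocations. -/
def attainable (μ : Measure A) (ϱ : A → Lp ℝ ∞ P → ℝ) (Z : Lp ℝ ∞ P) : Set ℝ :=
  {v | ∃ X ∈ feasible μ Z, Integrable (fun a => ϱ a (X a)) μ ∧ ∫ a, ϱ a (X a) ∂μ = v}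

/-- Allocations of risk `⊤` do not affect the infimum, and none has risk `⊥` because the infimum is
not `⊥`; so real-valued integrals suffice. -/
lemma isGLB_attainable (hϱ : MeasurableFamily ϱ) {Z : Lp ℝ ∞ P}
    (hbot : integralInfConv μ ϱ Z ≠ ⊥) {r : ℝ} (hr : integralInfConv μ ϱ Z = r) :
    IsGLB (attainable μ ϱ Z) r := by
  constructor
  · rintro v ⟨X, hX, hint, rfl⟩
    rw [← EReal.coe_le_coe_iff, ← hr, ← extIntegral_eq_coe_integral hint]
    exact iInf₂_le X hX
  · intro b hb
    rw [← EReal.coe_le_coe_iff, ← hr]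
    refine le_iInf₂ fun X hX => ?_
    by_cases htop : extIntegral μ (fun a => ϱ a (X a)) = ⊤
    · rw [htop]
      exact le_top
    · have hint := integrable_of_extIntegral_ne (hϱ X hX.1.1) htop fun h =>
        hbot (le_bot_iff.1 (h ▸ iInf₂_le X hX))
      rw [extIntegral_eq_coe_integral hint, EReal.coe_le_coe_iff]
      exact hb ⟨X, hX, hint, rfl⟩

lemma feasible_add_const [IsFiniteMeasure μ] {X : A → Lp ℝ ∞ P} {Z : Lp ℝ ∞ P}
    (hX : X ∈ feasible μ Z) (W : Lp ℝ ∞ P) :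
    (fun a => X a + W) ∈ feasible μ (Z + μ.real univ • W) := by
  obtain ⟨⟨hm, hi⟩, hg⟩ := hX
  refine ⟨⟨fun Y => ?_, fun Y => ?_⟩, fun Y => ?_⟩
  · simp only [pairing_add_left]
    exact (hm Y).add_const _
  · simp only [pairing_add_left]
    exact (hi Y).add (integrable_const _)
  · simp only [pairing_add_left, pairing_smul_left]
    rw [integral_add (hi Y) (integrable_const _), hg Y, integral_const, smul_eq_mul]

/-- Every agent receives the same nonpositive shift `(Z' - Z) / μ(A)`, which lowers each individual
risk. -/
lemma exists_attainable_le [IsFiniteMeasure μ] (hμ : 0 < μ univ) (hϱm : MeasurableFamily ϱ)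
    (hmono : ∀ a X Y, Y ≤ X → ϱ a Y ≤ ϱ a X)
    {Z Z' : Lp ℝ ∞ P} (hle : Z' ≤ Z) (hbot : integralInfConv μ ϱ Z' ≠ ⊥) {v : ℝ}
    (hv : v ∈ attainable μ ϱ Z) : ∃ v' ∈ attainable μ ϱ Z', v' ≤ v := by
  obtain ⟨X, hX, hint, rfl⟩ := hv
  have hm : 0 < μ.real univ := measureReal_pos_iff.2 hμ
  have hX' := feasible_add_const hX ((μ.real univ)⁻¹ • (Z' - Z))
  rw [smul_inv_smul₀ hm.ne', add_sub_cancel] at hX'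
  have hW : (μ.real univ)⁻¹ • (Z' - Z) ≤ 0 := by
    rw [← Lp.coeFn_le] at hle ⊢
    filter_upwards [hle, Lp.coeFn_smul (μ.real univ)⁻¹ (Z' - Z), Lp.coeFn_sub Z' Z,
      Lp.coeFn_zero ℝ ∞ P] with ω h h1 h2 h3
    rw [h1, h3, Pi.smul_apply, h2, Pi.sub_apply, Pi.zero_apply]
    exact smul_nonpos_of_nonneg_of_nonpos (inv_nonneg.2 hm.le) (sub_nonpos.2 h)
  have hle' : ∀ a, ϱ a (X a + (μ.real univ)⁻¹ • (Z' - Z)) ≤ ϱ a (X a) := fun a =>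
    hmono a _ _ (add_le_of_nonpos_right hW)
  have hint' : Integrable (fun a => ϱ a (X a + (μ.real univ)⁻¹ • (Z' - Z))) μ := by
    -- The positive part is dominated by the old one; an infinite negative part would force the
    -- convolution at `Z'` to be `⊥`.
    refine integrable_of_lintegral_ofReal_ne_top (hϱm _ hX'.1.1) (ne_top_of_le_ne_top
      hint.lintegral_lt_top.ne (lintegral_mono fun a => ENNReal.ofReal_le_ofReal (hle' a)))
      fun h => hbot (le_bot_iff.1 (h ▸ iInf₂_le _ hX'))
  exact ⟨_, ⟨_, hX', hint', rfl⟩, integral_mono hint' hint hle'⟩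

lemma add_mem_attainable [IsFiniteMeasure μ] (hμ : 0 < μ univ) [IsFiniteMeasure P]
    (hcash : ∀ a X c, ϱ a (X + Lp.const ∞ P c) = ϱ a X + c)
    {Z : Lp ℝ ∞ P} (c : ℝ) {v : ℝ} (hv : v ∈ attainable μ ϱ Z) :
    v + c ∈ attainable μ ϱ (Z + Lp.const ∞ P c) := by
  obtain ⟨X, hX, hint, rfl⟩ := hv
  have hm : μ.real univ ≠ 0 := (measureReal_pos_iff.2 hμ).ne'
  have hX' := feasible_add_const hX (Lp.const ∞ P ((μ.real univ)⁻¹ * c))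
  have hs : μ.real univ • Lp.const ∞ P ((μ.real univ)⁻¹ * c) = Lp.const ∞ P c := by
    have := (Lp.constₗ ∞ P ℝ).map_smul (μ.real univ) ((μ.real univ)⁻¹ * c)
    rw [smul_eq_mul, mul_inv_cancel_left₀ hm] at this
    exact this.symm
  rw [hs] at hX'
  refine ⟨_, hX', ?_, ?_⟩
  · simp only [hcash]
    exact hint.add (integrable_const _)
  · simp only [hcash]
    rw [integral_add hint (integrable_const _), integral_const, smul_eq_mul,
      mul_inv_cancel_left₀ hm]

open Classical in
lemma integral_piecewise_eq {f g : A → ℝ} (hf : Integrable f μ) (hg : Integrable g μ) {B : Set A}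
    (hB : MeasurableSet B) {t : ℝ} (htf : ∫ a in B, f a ∂μ = t * ∫ a, f a ∂μ)
    (htg : ∫ a in B, g a ∂μ = t * ∫ a, g a ∂μ) :
    ∫ a, B.piecewise f g a ∂μ = t * ∫ a, f a ∂μ + (1 - t) * ∫ a, g a ∂μ := by
  rw [integral_piecewise hB hf.integrableOn hg.integrableOn, htf]
  have := integral_add_compl hB hg
  linear_combination this - htg

/-- Lyapunov's theorem makes the set of attainable aggregate risks jointly convex. -/
lemma convexCombo_mem_attainable [IsFiniteMeasure μ] (hμ : IsNonatomic μ) [IsFiniteMeasure P]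
    (hF : {s : Set Ω | MeasurableSet s}.Finite) {Z Z' : Lp ℝ ∞ P} {v v' t : ℝ}
    (hv : v ∈ attainable μ ϱ Z) (hv' : v' ∈ attainable μ ϱ Z') (ht0 : 0 ≤ t) (ht1 : t ≤ 1) :
    t * v + (1 - t) * v' ∈ attainable μ ϱ (t • Z + (1 - t) • Z') := by
  classical
  obtain ⟨X, ⟨⟨hXm, hXi⟩, hXg⟩, hX, rfl⟩ := hv
  obtain ⟨X', ⟨⟨hXm', hXi'⟩, hXg'⟩, hX', rfl⟩ := hv'
  obtain ⟨W, hW, hspan⟩ := exists_finite_span_eq_top (P := P) hF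
  let p : (A → Lp ℝ ∞ P) → Lp ℝ 1 P → A → ℝ := fun X Y a => pairing P (X a) Y
  -- The risk functions join the pairings in the Lyapunov family, so no convexity of `ϱ a` is
  -- needed.
  obtain ⟨B, hB, hBe⟩ := hμ.exists_setIntegral_eq_mul
    (F := {fun a => ϱ a (X a), fun a => ϱ a (X' a)} ∪ (p X '' W ∪ p X' '' W))
    ((toFinite _).union ((hW.image _).union (hW.image _)))
    (by
      rintro f ((rfl | rfl) | ⟨Y, -, rfl⟩ | ⟨Y, -, rfl⟩)
      exacts [hX, hX', hXi Y, hXi' Y]) ht0 ht1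
  -- The fraction identity is linear in `Y`, so it passes from the spanning set to all of `L^1`.
  have hext : ∀ X : A → Lp ℝ ∞ P, (∀ Y, Integrable (p X Y) μ) →
      (∀ Y ∈ W, ∫ a in B, p X Y a ∂μ = t * ∫ a, p X Y a ∂μ) →
      ∀ Y, ∫ a in B, p X Y a ∂μ = t * ∫ a, p X Y a ∂μ := by
    intro X hi hYW Y
    have hY : Y ∈ Submodule.span ℝ W := hspan ▸ Submodule.mem_top
    induction hY using Submodule.span_induction with
    | mem Y hY => exact hYW Y hY
    | zero => simp [p, pairing_zero_right]
    | add Y Y' _ _ h h' =>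
      simp only [p, pairing_add_right] at h h' ⊢
      rw [integral_add (hi Y) (hi Y'), integral_add (hi Y).integrableOn (hi Y').integrableOn,
        h, h', mul_add]
    | smul c Y _ h =>
      simp only [p, pairing_smul_right, integral_const_mul] at h ⊢
      rw [h, mul_left_comm]
  have hp : ∀ Y, (fun a => pairing P (B.piecewise X X' a) Y) = B.piecewise (p X Y) (p X' Y) :=
    fun Y => funext fun a => by by_cases h : a ∈ B <;> simp [h, p]
  have hϱ : (fun a => ϱ a (B.piecewise X X' a)) =
      B.piecewise (fun a => ϱ a (X a)) fun a => ϱ a (X' a) :=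
    funext fun a => by by_cases h : a ∈ B <;> simp [h]
  refine ⟨B.piecewise X X', ⟨⟨fun Y => ?_, fun Y => ?_⟩, fun Y => ?_⟩, ?_, ?_⟩
  · rw [hp]
    exact (hXm Y).piecewise hB (hXm' Y)
  · rw [hp]
    exact Integrable.piecewise hB (hXi Y).integrableOn (hXi' Y).integrableOn
  · rw [hp, integral_piecewise_eq (hXi Y) (hXi' Y) hB
      (hext X hXi (fun Y hY => hBe _ (.inr (.inl ⟨Y, hY, rfl⟩))) Y)
      (hext X' hXi' (fun Y hY => hBe _ (.inr (.inr ⟨Y, hY, rfl⟩))) Y),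
      pairing_add_left, pairing_smul_left, pairing_smul_left, hXg Y, hXg' Y]
  · rw [hϱ]
    exact Integrable.piecewise hB hX.integrableOn hX'.integrableOn
  · rw [hϱ, integral_piecewise_eq hX hX' hB (hBe _ (.inl (.inl rfl))) (hBe _ (.inl (.inr rfl)))]

end Feasible

end RiskSharing

/-! ### The convolution is a convex risk measure -/

theorem theorem3p1
    {A : Type*} [MeasurableSpace A] (μ : Measure A) [μ.IsComplete] [IsFiniteMeasure μ]
    (hμ_pos : 0 < μ Set.univ) (hμ : RiskSharing.IsNonatomic μ)
    {Ω : Type*} [MeasurableSpace Ω] (P : Measure Ω) [IsProbabilityMeasure P]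
    (hF : {s : Set Ω | MeasurableSet s}.Finite)
    (ϱ : A → Lp ℝ ∞ P → ℝ)
    (hϱ : ∀ a, RiskSharing.IsRiskMeasure (ϱ a))
    (hϱ_meas : RiskSharing.MeasurableFamily ϱ)
    (hfin : ∀ X : Lp ℝ ∞ P, RiskSharing.integralInfConv μ ϱ X ≠ ⊥ ∧
      RiskSharing.integralInfConv μ ϱ X ≠ ⊤) :
    ∃ R : Lp ℝ ∞ P → ℝ,
      (∀ X : Lp ℝ ∞ P, RiskSharing.integralInfConv μ ϱ X = (R X : EReal)) ∧
        RiskSharing.IsConvexRiskMeasure R := by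
  let R : Lp ℝ ∞ P → ℝ := fun X => (RiskSharing.integralInfConv μ ϱ X).toReal
  have hR : ∀ X, RiskSharing.integralInfConv μ ϱ X = (R X : EReal) := fun X =>
    (EReal.coe_toReal (hfin X).2 (hfin X).1).symm
  have hglb : ∀ X, IsGLB (RiskSharing.attainable μ ϱ X) (R X) := fun X =>
    RiskSharing.isGLB_attainable hϱ_meas (hfin X).1 (hR X)
  have hcash : ∀ X c, R (X + Lp.const ∞ P c) ≤ R X + c := fun X c =>
    sub_le_iff_le_add.1 <| (le_isGLB_iff (hglb X)).2 fun v hv => sub_le_iff_le_add.2 <|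
      (hglb _).1 (RiskSharing.add_mem_attainable hμ_pos (fun a => (hϱ a).cash_additive) c hv)
  refine ⟨R, hR, ⟨⟨fun X Y hYX => ?_, fun X c => (hcash X c).antisymm ?_⟩,
    fun X Y t ht0 ht1 => le_of_forall_pos_le_add fun ε hε => ?_⟩⟩
  · refine (le_isGLB_iff (hglb X)).2 fun v hv => ?_
    obtain ⟨v', hv', hle⟩ := RiskSharing.exists_attainable_le hμ_pos hϱ_meas
      (fun a => (hϱ a).monotone) hYX (hfin Y).1 hv
    exact ((hglb Y).1 hv').trans hle
  -- The reverse inequality is the same one after subtracting the cash again.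
  · have := hcash (X + Lp.const ∞ P c) (-c)
    rw [map_neg, add_neg_cancel_right] at this
    linarith
  -- Combine `ε`-optimal attainable risks; the weights sum to 1, so the total error is `ε`.
  · obtain ⟨v, hv, -, hvε⟩ := (hglb X).exists_between (lt_add_of_pos_right _ hε)
    obtain ⟨w, hw, -, hwε⟩ := (hglb Y).exists_between (lt_add_of_pos_right _ hε)
    have h := (hglb _).1 (RiskSharing.convexCombo_mem_attainable hμ hF hv hw ht0 ht1)
    have h1 := mul_le_mul_of_nonneg_left hvε.le ht0
    have h2 := mul_le_mul_of_nonneg_left hwε.le (sub_nonneg.2 ht1)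
    linarith
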